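/- Let $M$ be a monoid that is cancellative, i.e. all left multiplications $L_s\colon t\mapsto st$ and all right multiplications $R_s\colon t\mapsto ts$ ($s\in M$) are injective. Suppose that $M$ is left-amenable or right-amenable; that is, there is a positive linear functional $m$ on the space $\ell^\infty(M)$ of bounded real-valued functions on $M$, with $m(1)=1$, such that $m(f\circ L_s)=m(f)$ for all $f\in\ell^\infty(M)$ and $s\in M$ (left-amenable), respectively $m(f\circ R_s)=m(f)$ for all $f\in\ell^\infty(M)$ and $s\in M$ (right-amenable). Then $M$ is sofic: for every finite subset $K\subset M$ and every $\varepsilon>0$ there exist a non-empty finite set $X$ and a map $\varphi\colon M\to \mathrm{Map}(X)$ such that \[ d(\varphi(k_1k_2),\varphi(k_1)\varphi(k_2))\le\varepsilon \ \text{ for all } k_1,k_2\in K,\qquad d(\varphi(1_M),\mathrm{Id}_X)\le\varepsilon, \] \[ d(\varphi(k_1),\varphi(k_2))\ge 1-\varepsilon \ \text{ for all distinct } k_1,k_2\in K, \] where $\mathrm{Map}(X)$ is the monoid of all maps $X\to X$ under composition and $d(f,g)=|\{x\in X: f(x)\ne g(x)\}|/|X|$ is the normalized Hamming metric. -/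

import Mathlib

open scoped ENNReal

namespace SoficMonoids

/-! ### Almost morphisms and sofic monoids -/

/-- The normalized Hamming metric on the symmetric monoid `Map(X) = Function.End X` (all maps
`X → X` under composition) of a finite set `X`:
`d(f, g) = |{x ∈ X : f x ≠ g x}| / |X|`. -/
noncomputable def hammingMetric {X : Type*} [Fintype X] (f g : Function.End X) : ℝ :=
  (Nat.card {x : X // f x ≠ g x} : ℝ) / (Fintype.card X : ℝ)

/-- `φ : M → N` is a `(K, ε)`-morphism with respect to the metric `d` on the monoid `N`. -/
def IsAlmostMorphism {M N : Type*} [Monoid M] [Monoid N] (d : N → N → ℝ)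
    (K : Set M) (ε : ℝ) (φ : M → N) : Prop :=
  (∀ k₁ ∈ K, ∀ k₂ ∈ K, d (φ (k₁ * k₂)) (φ k₁ * φ k₂) ≤ ε) ∧ d (φ 1) 1 ≤ ε

/-- `φ : M → N` is `(K, α)`-injective with respect to the metric `d` on `N`. -/
def IsAlmostInjective {M N : Type*} (d : N → N → ℝ)
    (K : Set M) (α : ℝ) (φ : M → N) : Prop :=
  ∀ k₁ ∈ K, ∀ k₂ ∈ K, k₁ ≠ k₂ → α ≤ d (φ k₁) (φ k₂)

/-- A monoid `M` is sofic if for every finite `K ⊆ M` and every `ε > 0` there are a non-empty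
finite set `X` and a `(K, 1 - ε)`-injective `(K, ε)`-morphism `M → Map(X)`. -/
def IsSofic (M : Type*) [Monoid M] : Prop :=
  ∀ (K : Finset M) (ε : ℝ), 0 < ε →
    ∃ (X : Type) (_ : Fintype X) (_ : Nonempty X) (φ : M → Function.End X),
      IsAlmostInjective hammingMetric (K : Set M) (1 - ε) φ ∧
      IsAlmostMorphism hammingMetric (K : Set M) ε φ

/-! ### Invariant means and amenability -/

/-- The real Banach space of bounded real-valued functions on `S`. -/
abbrev BoundedFunctions (S : Type*) : Type _ := lp (fun _ : S => ℝ) ∞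

/-- Precomposition `f ↦ f ∘ u` of a bounded function on `S` with a map `u : S → S`. -/
def precomp {S : Type*} (u : S → S) (f : BoundedFunctions S) : BoundedFunctions S :=
  ⟨fun t => f (u t), by
    refine memℓp_infty ⟨‖f‖, ?_⟩
    rintro _ ⟨t, rfl⟩
    exact lp.norm_apply_le_norm ENNReal.top_ne_zero f (u t)⟩

/-- A mean on `S`: a linear functional on the bounded functions on `S` that is positive and
takes the value `1` at the constant function `1`. -/
structure IsMean {S : Type*} (m : BoundedFunctions S →ₗ[ℝ] ℝ) : Prop where
  nonneg : ∀ f : BoundedFunctions S, (∀ t, 0 ≤ f t) → 0 ≤ m f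
  map_one : m 1 = 1

/-- `S` is left-amenable if there is a mean on `S` that is invariant under all left
multiplications: `m (f ∘ L_s) = m f`, where `L_s t = s * t`. -/
def IsLeftAmenable (S : Type*) [Semigroup S] : Prop :=
  ∃ m : BoundedFunctions S →ₗ[ℝ] ℝ, IsMean m ∧
    ∀ (s : S) (f : BoundedFunctions S), m (precomp (fun t => s * t) f) = m f

/-- `S` is right-amenable if there is a mean on `S` that is invariant under all right
multiplications: `m (f ∘ R_s) = m f`, where `R_s t = t * s`. -/
def IsRightAmenable (S : Type*) [Semigroup S] : Prop :=
  ∃ m : BoundedFunctions S →ₗ[ℝ] ℝ, IsMean m ∧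
    ∀ (s : S) (f : BoundedFunctions S), m (precomp (fun t => t * s) f) = m f

end SoficMonoids

namespace SoficMonoids

open MeasureTheory

/-! An invariant mean yields Følner sets: Hahn–Banach in `ℓ¹` gives almost invariant finitely
supported densities (`exists_almost_invariant_density`), and one of their level sets is almost
invariant (`exists_level_set`). Translations restrict to a partial action on a Følner set, defined
off a small proportion of points; any extension to total maps is an almost morphism
(`exists_almost_morphism_of_partial_action`). Cancellation makes translations injective on one side
and the partial action free on the other, so distinct elements agree only at exceptional points. -/

/-! ### Means and almost invariant densities -/

lemma IsMean.mono {S : Type*} {m : BoundedFunctions S →ₗ[ℝ] ℝ} (hm : IsMean m)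
    {f g : BoundedFunctions S} (h : ∀ t, f t ≤ g t) : m f ≤ m g := by
  have := hm.nonneg (g - f) fun t => by simpa using h t
  rw [map_sub] at this
  linarith

/-- Point mass at `x`, as an element of `ℓ¹(S)`. -/
noncomputable def pointMass {S : Type*} (x : S) : lp (fun _ : S => ℝ) 1 := by
  classical exact lp.single 1 x (1 : ℝ)

open Classical in
lemma pointMass_apply {S : Type*} (x y : S) : pointMass x y = if y = x then (1 : ℝ) else 0 := by
  rw [pointMass, lp.single_apply, Pi.single_apply]

lemma norm_pointMass {S : Type*} (x : S) : ‖pointMass x‖ = 1 := by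
  classical
  rw [pointMass, lp.norm_single one_pos]
  simp

/-- A continuous functional on `ℓ¹(S)` is given by a bounded function. -/
noncomputable def dualToBounded {S : Type*} (f : StrongDual ℝ (lp (fun _ : S => ℝ) 1)) :
    BoundedFunctions S :=
  ⟨fun x => f (pointMass x), by
    refine memℓp_infty ⟨‖f‖, ?_⟩
    rintro _ ⟨x, rfl⟩
    simpa [norm_pointMass] using f.le_opNorm (pointMass x)⟩

/-- The family of differences `u i · δ_x - δ_x`. -/
noncomputable def displacement {ι S : Type*} (u : ι → S → S) (x : S) :
    ι → lp (fun _ : S => ℝ) 1 :=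
  fun i => pointMass (u i x) - pointMass x

/-- The finitely supported probability densities on `S`. -/
def finDensities (S : Type*) : Set (S →₀ ℝ) :=
  {p | (∀ x, 0 ≤ p x) ∧ ∑ x ∈ p.support, p x = 1}

lemma convex_finDensities (S : Type*) : Convex ℝ (finDensities S) := by
  have h : finDensities S =
      {p | (∀ x, 0 ≤ p x) ∧ Finsupp.linearCombination ℝ (fun _ : S => (1 : ℝ)) p = 1} := by
    ext p
    simp [finDensities, Finsupp.linearCombination_apply, Finsupp.sum]
  rw [h]
  rintro p ⟨hp, hp1⟩ q ⟨hq, hq1⟩ a b ha hb hab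
  refine ⟨fun x => ?_, ?_⟩
  · have := hp x
    have := hq x
    simp only [Finsupp.add_apply, Finsupp.smul_apply, smul_eq_mul]
    positivity
  · rw [map_add, map_smul, map_smul, hp1, hq1]
    simpa using hab

/-- Otherwise a functional separates `0` from the closed convex hull of the displacements. Its
coordinates are bounded functions `g i` with `∑ i, (g i ∘ u i - g i) ≥ c > 0` pointwise, and
applying the invariant `m` gives `0 ≥ c`. -/
lemma zero_mem_closure_displacement {ι S : Type*} [Fintype ι] (u : ι → S → S)
    {m : BoundedFunctions S →ₗ[ℝ] ℝ} (hm : IsMean m)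
    (hu : ∀ i f, m (precomp (u i) f) = m f) :
    (0 : ι → lp (fun _ : S => ℝ) 1) ∈
      closure (Finsupp.linearCombination ℝ (displacement u) '' finDensities S) := by
  classical
  by_contra h0
  obtain ⟨f, c, hc, hf⟩ := geometric_hahn_banach_point_closed
    ((convex_finDensities S).linear_image _).closure isClosed_closure h0
  rw [map_zero] at hc
  have hpt : ∀ x, c ≤ f (displacement u x) := fun x => by
    refine (hf _ (subset_closure ⟨Finsupp.single x 1, ⟨fun y => ?_, ?_⟩, ?_⟩)).le
    · rw [Finsupp.single_apply]
      split_ifs <;> norm_num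
    · rw [Finsupp.support_single _ one_ne_zero]
      simp
    · simp
  let g : ι → BoundedFunctions S := fun i =>
    dualToBounded (f.comp (ContinuousLinearMap.single ℝ (fun _ : ι => lp (fun _ : S => ℝ) 1) i))
  have hle : m (c • 1) ≤ m (∑ i, (precomp (u i) (g i) - g i)) := by
    refine hm.mono fun x => ?_
    have hx : f (displacement u x) = ∑ i, (g i (u i x) - g i x) := by
      conv_lhs => rw [← Finset.univ_sum_single (displacement u x), map_sum]
      refine Finset.sum_congr rfl fun i _ => ?_
      change f (Pi.single i (pointMass (u i x) - pointMass x)) =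
        f (Pi.single i (pointMass (u i x))) - f (Pi.single i (pointMass x))
      rw [Pi.single_sub, map_sub]
    have h1 : (c • (1 : BoundedFunctions S)) x = c := by
      change c * 1 = c
      ring
    rw [h1, lp.coeFn_sum, Finset.sum_apply]
    exact (hpt x).trans hx.le
  rw [map_smul, hm.map_one, map_sum] at hle
  simp only [map_sub, hu, sub_self, Finset.sum_const_zero, smul_eq_mul, mul_one] at hle
  linarith

lemma linearCombination_displacement_apply {ι S : Type*} (u : ι → S → S) {i : ι}
    (hi : Function.Injective (u i)) (p : S →₀ ℝ) (y : S) :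
    Finsupp.linearCombination ℝ (displacement u) p i (u i y) = p y - p (u i y) := by
  classical
  induction p using Finsupp.induction_linear with
  | zero => simp
  | add p q hp hq =>
    rw [map_add, Pi.add_apply, lp.coeFn_add, Pi.add_apply, hp, hq, Finsupp.add_apply,
      Finsupp.add_apply]
    ring
  | single x c =>
    rw [Finsupp.linearCombination_single, Pi.smul_apply, lp.coeFn_smul, Pi.smul_apply,
      displacement, lp.coeFn_sub, Pi.sub_apply, pointMass_apply, pointMass_apply,
      Finsupp.single_apply, Finsupp.single_apply, hi.eq_iff]
    simp only [eq_comm (a := x)]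
    split_ifs <;> simp

/-- **Day's theorem**: an invariant mean yields almost invariant finitely supported densities. -/
lemma exists_almost_invariant_density {ι S : Type*} [Fintype ι] (u : ι → S → S)
    (hinj : ∀ i, Function.Injective (u i))
    {m : BoundedFunctions S →ₗ[ℝ] ℝ} (hm : IsMean m)
    (hu : ∀ i f, m (precomp (u i) f) = m f) {ε : ℝ} (hε : 0 < ε) :
    ∃ p ∈ finDensities S, ∀ i, ∑ y ∈ p.support, |p y - p (u i y)| < ε := by
  classical
  obtain ⟨_, ⟨p, hp, rfl⟩, hw⟩ :=
    Metric.mem_closure_iff.1 (zero_mem_closure_displacement u hm hu) ε hε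
  rw [dist_zero_left] at hw
  refine ⟨p, hp, fun i => lt_of_le_of_lt ?_ ((norm_le_pi_norm _ i).trans_lt hw)⟩
  -- Part of the `ℓ¹` norm suffices: the terms at points `u i y` with `y` in the support.
  have h := lp.sum_rpow_le_norm_rpow (p := 1) (by simp)
    (Finsupp.linearCombination ℝ (displacement u) p i) (p.support.image (u i))
  rw [Finset.sum_image fun _ _ _ _ h => hinj i h] at h
  simpa [linearCombination_displacement_apply u (hinj i)] using h

/-! ### Level sets and Følner sets -/

lemma integral_indicator_Ico (a b : ℝ) :
    ∫ t, (Set.Ico a b).indicator (fun _ => (1 : ℝ)) t = max (b - a) 0 := by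
  rw [integral_indicator measurableSet_Ico]
  simp [Measure.real, Real.volume_Ico, ENNReal.toReal_ofReal']

lemma integrable_indicator_Ico (a b : ℝ) :
    Integrable ((Set.Ico a b).indicator fun _ => (1 : ℝ)) :=
  (integrable_indicator_iff measurableSet_Ico).2 (integrableOn_const (by simp))

open Classical in
/-- **Namioka's argument**: some level set of an almost invariant density is almost invariant. -/
lemma exists_level_set {ι S : Type*} [Fintype ι] (u : ι → S → S) {p : S →₀ ℝ} {ε : ℝ}
    (hp : ∀ x, 0 ≤ p x)
    (h : ∑ i, ∑ y ∈ p.support, |p y - p (u i y)| < ε * ∑ y ∈ p.support, p y) :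
    ∃ F : Finset S, (∑ i, (F.filter fun x => u i x ∉ F).card : ℝ) < ε * F.card := by
  by_contra! hF
  -- Layer cake: for `t ≥ 0` the left sum counts the level set `{p > t}`, the right one its points
  -- leaving it under `u i`. Integrating over `t` contradicts `h`.
  have key : ∀ t : ℝ, ε * ∑ y ∈ p.support, (Set.Ico 0 (p y)).indicator (fun _ => (1 : ℝ)) t ≤
      ∑ i, ∑ y ∈ p.support, (Set.Ico (p (u i y)) (p y)).indicator (fun _ => (1 : ℝ)) t := by
    intro t
    rcases lt_or_ge t 0 with ht | ht
    · have : ∀ y, (Set.Ico 0 (p y)).indicator (fun _ => (1 : ℝ)) t = 0 := fun y =>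
        Set.indicator_of_notMem (fun h => ht.not_ge h.1) _
      simp only [this, Finset.sum_const_zero, mul_zero]
      exact Finset.sum_nonneg fun i _ => Finset.sum_nonneg fun y _ =>
        Set.indicator_nonneg (fun _ _ => zero_le_one) _
    · refine (le_of_eq ?_).trans
        ((hF (p.support.filter fun x => t < p x)).trans (le_of_eq ?_))
      · congr 1
        rw [Finset.card_filter, Nat.cast_sum]
        refine Finset.sum_congr rfl fun y _ => ?_
        simp [Set.indicator_apply, ht]
      · refine Finset.sum_congr rfl fun i _ => ?_
        rw [Finset.filter_filter, Finset.card_filter, Nat.cast_sum]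
        refine Finset.sum_congr rfl fun y _ => ?_
        have : u i y ∉ p.support.filter (fun x => t < p x) ↔ p (u i y) ≤ t := by
          simp only [Finset.mem_filter, Finsupp.mem_support_iff, not_and, not_lt]
          refine ⟨fun h => ?_, fun h _ => h⟩
          by_cases h0 : p (u i y) = 0
          · rw [h0]
            exact ht
          · exact h h0
        simp only [Set.indicator_apply, Set.mem_Ico, this, and_comm, Nat.cast_ite, Nat.cast_one,
          Nat.cast_zero]
  have hint := integral_mono
    ((integrable_finsetSum _ fun y _ => integrable_indicator_Ico 0 (p y)).const_mul ε)
    (integrable_finsetSum _ fun i _ => integrable_finsetSum _ fun y _ =>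
      integrable_indicator_Ico (p (u i y)) (p y)) key
  rw [integral_const_mul, integral_finsetSum _ fun y _ => integrable_indicator_Ico 0 (p y),
    integral_finsetSum _ fun i _ => integrable_finsetSum _ fun y _ =>
      integrable_indicator_Ico (p (u i y)) (p y)] at hint
  simp only [integral_finsetSum _ fun y _ => integrable_indicator_Ico _ (p y),
    integral_indicator_Ico, sub_zero, max_eq_left (hp _)] at hint
  refine (hint.trans (Finset.sum_le_sum fun i _ => Finset.sum_le_sum fun y _ => ?_)).not_gt h
  exact max_le (le_abs_self _) (abs_nonneg _)

open Classical in
/-- **Følner's condition** for a finite family of injective maps preserving a mean. -/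
lemma exists_folner_set {ι S : Type*} [Fintype ι] (u : ι → S → S)
    (hinj : ∀ i, Function.Injective (u i))
    {m : BoundedFunctions S →ₗ[ℝ] ℝ} (hm : IsMean m)
    (hu : ∀ i f, m (precomp (u i) f) = m f) {ε : ℝ} (hε : 0 < ε) :
    ∃ F : Finset S, F.Nonempty ∧
      ∀ i, ((F.filter fun x => u i x ∉ F).card : ℝ) ≤ ε * F.card := by
  -- The `+ 1` keeps the total strictly below `ε` and covers empty `ι`.
  obtain ⟨p, ⟨hp, hp1⟩, hpu⟩ := exists_almost_invariant_density u hinj hm hu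
    (ε := ε / (Fintype.card ι + 1)) (by positivity)
  obtain ⟨F, hF⟩ := exists_level_set u (ε := ε) hp (by
    rw [hp1, mul_one]
    calc _ ≤ ∑ _i : ι, ε / (Fintype.card ι + 1) := Finset.sum_le_sum fun i _ => (hpu i).le
      _ = ε * (Fintype.card ι / (Fintype.card ι + 1)) := by
        rw [Finset.sum_const, Finset.card_univ, nsmul_eq_mul]
        ring
      _ < ε * 1 := by
        refine mul_lt_mul_of_pos_left ?_ hε
        rw [div_lt_one (by positivity)]
        linarith
      _ = ε := mul_one ε)
  refine ⟨F, ?_, fun i => le_trans ?_ hF.le⟩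
  · by_contra hne
    rw [Finset.not_nonempty_iff_eq_empty] at hne
    simp [hne] at hF
  · exact Finset.single_le_sum (f := fun i => ((F.filter fun x => u i x ∉ F).card : ℝ))
      (fun _ _ => Nat.cast_nonneg _) (Finset.mem_univ i)

/-- Følner's condition in terms of an enumeration of the almost invariant set. -/
lemma exists_folner_enumeration {M S : Type*} (u : M → S → S)
    (hinj : ∀ s, Function.Injective (u s))
    {m : BoundedFunctions S →ₗ[ℝ] ℝ} (hm : IsMean m)
    (hu : ∀ s f, m (precomp (u s) f) = m f) (K : Finset M) {ε : ℝ} (hε : 0 < ε) :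
    ∃ (n : ℕ) (i : Fin (n + 1) → S), Function.Injective i ∧
      ∀ k ∈ K, (Nat.card {x // ¬ ∃ y, u k (i x) = i y} : ℝ) ≤ ε * (n + 1 : ℕ) := by
  classical
  obtain ⟨F, hF, h⟩ := exists_folner_set (fun k : K => u k) (fun k => hinj k) hm
    (fun k => hu k) hε
  obtain ⟨n, hn⟩ := Nat.exists_eq_add_one.2 hF.card_pos
  -- `IsSofic` needs a set in `Type`, whatever the universe of `S`.
  let e : Fin (n + 1) ≃ F := (F.equivFinOfCardEq hn).symm
  have hmem : ∀ z, z ∈ F ↔ ∃ y, z = e y := fun z =>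
    ⟨fun hz => ⟨e.symm ⟨z, hz⟩, by simp⟩, by rintro ⟨y, rfl⟩; exact (e y).2⟩
  refine ⟨n, fun x => e x, Subtype.val_injective.comp e.injective, fun k hk => ?_⟩
  refine le_trans ?_ ((h ⟨k, hk⟩).trans_eq (by rw [hn]))
  rw [Nat.card_eq_fintype_card, ← Fintype.card_coe]
  refine Nat.cast_le.2 (Fintype.card_le_of_injective
    (fun x => ⟨e x.1, Finset.mem_filter.2 ⟨(e x.1).2, fun hz => x.2 ((hmem _).1 hz)⟩⟩) ?_)
  intro x y hxy
  have h1 : (e x.1 : S) = e y.1 := by simpa only [Subtype.mk.injEq] using hxy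
  exact Subtype.ext (e.injective (Subtype.ext h1))

/-! ### From partial actions to soficity -/

lemma natCard_le_add {X : Type*} [Finite X] {P Q R : X → Prop} (h : ∀ x, P x → Q x ∨ R x) :
    (Nat.card {x // P x} : ℝ) ≤ Nat.card {x // Q x} + Nat.card {x // R x} := by
  have h1 : Set.ncard {x | P x} ≤ Set.ncard ({x | Q x} ∪ {x | R x}) :=
    Set.ncard_le_ncard h (Set.toFinite _)
  exact_mod_cast h1.trans (Set.ncard_union_le _ _)

/-- Almost everywhere defined, free partial actions on finite sets yield almost morphisms. -/
lemma exists_almost_morphism_of_partial_action {M X : Type*} [Monoid M] [Fintype X] [Nonempty X]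
    (K : Set M) {ε : ℝ} (hε : 0 < ε) (r : M → X → X → Prop)
    (hfun : ∀ s x y z, r s x y → r s x z → y = z)
    (hmul : ∀ s t x y z, r t x y → r (s * t) x z → r s y z)
    (hone : ∀ x, r 1 x x)
    (hfree : ∀ s t x y, r s x y → r t x y → s = t)
    (hK : ∀ k ∈ K, (Nat.card {x // ¬ ∃ y, r k x y} : ℝ) ≤ ε / 2 * Fintype.card X)
    (hKK : ∀ k ∈ K, ∀ l ∈ K,
      (Nat.card {x // ¬ ∃ y, r (k * l) x y} : ℝ) ≤ ε / 2 * Fintype.card X) :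
    ∃ φ : M → Function.End X, IsAlmostInjective hammingMetric K (1 - ε) φ ∧
      IsAlmostMorphism hammingMetric K ε φ := by
  classical
  -- The default value `x` is immaterial except at exceptional points; each estimate meets two
  -- exceptional sets, hence `ε / 2`.
  let φ : M → Function.End X := fun s x => if h : ∃ y, r s x y then h.choose else x
  have hφ : ∀ s x y, r s x y → φ s x = y := fun s x y h => by
    have hex : ∃ y, r s x y := ⟨y, h⟩
    change (if h : ∃ y, r s x y then h.choose else x) = y
    rw [dif_pos hex]
    exact hfun s x _ _ hex.choose_spec h
  have hX : (0 : ℝ) < Fintype.card X := Nat.cast_pos.2 Fintype.card_pos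
  refine ⟨φ, fun k hk l hl hne => ?_, fun k hk l hl => ?_, ?_⟩
  · have h1 : (Nat.card {x // φ k x = φ l x} : ℝ) ≤ _ :=
      natCard_le_add (Q := fun x => ¬ ∃ y, r k x y) (R := fun x => ¬ ∃ y, r l x y) (by
        intro x hx
        by_contra! hcon
        obtain ⟨⟨y, hy⟩, ⟨z, hz⟩⟩ := hcon
        rw [hφ _ _ _ hy, hφ _ _ _ hz] at hx
        subst hx
        exact hne (hfree _ _ _ _ hy hz))
    have h2 : Nat.card {x // φ k x ≠ φ l x} + Nat.card {x // φ k x = φ l x} =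
        Fintype.card X := by
      rw [Nat.card_eq_fintype_card, Nat.card_eq_fintype_card,
        Fintype.card_subtype_compl fun x => φ k x = φ l x]
      exact Nat.sub_add_cancel (Fintype.card_subtype_le _)
    have h3 : (Nat.card {x // φ k x ≠ φ l x} : ℝ) + Nat.card {x // φ k x = φ l x} =
        Fintype.card X := by exact_mod_cast h2
    rw [hammingMetric, le_div_iff₀ hX]
    linarith [hK k hk, hK l hl]
  · have h1 : (Nat.card {x // φ (k * l) x ≠ (φ k * φ l) x} : ℝ) ≤ _ :=
      natCard_le_add (Q := fun x => ¬ ∃ y, r l x y) (R := fun x => ¬ ∃ y, r (k * l) x y) (by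
        intro x hx
        by_contra! hcon
        obtain ⟨⟨y, hy⟩, ⟨z, hz⟩⟩ := hcon
        refine hx ?_
        change φ (k * l) x = φ k (φ l x)
        rw [hφ _ _ _ hy, hφ _ _ _ hz, hφ _ _ _ (hmul _ _ _ _ _ hy hz)])
    rw [hammingMetric, div_le_iff₀ hX]
    linarith [hK l hl, hKK k hk l hl]
  · have h1 : φ 1 = 1 := funext fun x => hφ _ _ _ (hone x)
    simpa [h1, hammingMetric] using hε.le

/-- A partial injection has domain and range of equal size. -/
lemma natCard_not_exists_swap {X : Type*} [Fintype X] (r : X → X → Prop)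
    (h₁ : ∀ x y z, r x y → r x z → y = z) (h₂ : ∀ x y z, r x z → r y z → x = y) :
    Nat.card {y // ¬ ∃ x, r x y} = Nat.card {x // ¬ ∃ y, r x y} := by
  classical
  have h : Fintype.card {y // ∃ x, r x y} = Fintype.card {x // ∃ y, r x y} :=
    Fintype.card_congr
      { toFun := fun y => ⟨y.2.choose, y.1, y.2.choose_spec⟩
        invFun := fun x => ⟨x.2.choose, x.1, x.2.choose_spec⟩
        left_inv := fun y => Subtype.ext (h₁ _ _ _
          (Exists.choose_spec (⟨y.1, y.2.choose_spec⟩ : ∃ z, r y.2.choose z)) y.2.choose_spec)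
        right_inv := fun x => Subtype.ext (h₂ _ _ _
          (Exists.choose_spec (⟨x.1, x.2.choose_spec⟩ : ∃ z, r z x.2.choose)) x.2.choose_spec) }
  rw [Nat.card_eq_fintype_card, Nat.card_eq_fintype_card, Fintype.card_subtype_compl,
    Fintype.card_subtype_compl, h]

lemma IsLeftAmenable.isSofic {M : Type*} [Monoid M] [IsCancelMul M] (hM : IsLeftAmenable M) :
    IsSofic M := by
  classical
  intro K ε hε
  obtain ⟨m, hm, hinv⟩ := hM
  obtain ⟨n, i, hi, h⟩ := exists_folner_enumeration (fun s t : M => s * t)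
    (fun s => mul_right_injective s) hm hinv (K ∪ Finset.image₂ (· * ·) K K) (half_pos hε)
  refine ⟨Fin (n + 1), inferInstance, inferInstance,
    exists_almost_morphism_of_partial_action (K : Set M) hε (fun s x y => s * i x = i y)
      (fun s x y z hy hz => hi (hy.symm.trans hz)) ?_ (fun x => one_mul _)
      (fun s t x y hs ht => mul_left_injective (i x) (hs.trans ht.symm)) ?_ ?_⟩
  · intro s t x y z hy hz
    rw [← hy, ← mul_assoc, hz]
  · intro k hk
    rw [Fintype.card_fin]
    exact h k (Finset.mem_union_left _ hk)
  · intro k hk l hl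
    rw [Fintype.card_fin]
    exact h (k * l) (Finset.mem_union_right _ (Finset.mem_image₂_of_mem hk hl))

lemma IsRightAmenable.isSofic {M : Type*} [Monoid M] [IsCancelMul M] (hM : IsRightAmenable M) :
    IsSofic M := by
  classical
  intro K ε hε
  obtain ⟨m, hm, hinv⟩ := hM
  obtain ⟨n, i, hi, h⟩ := exists_folner_enumeration (fun s t : M => t * s)
    (fun s => mul_left_injective s) hm hinv (K ∪ Finset.image₂ (· * ·) K K) (half_pos hε)
  have hswap : ∀ k, Nat.card {x // ¬ ∃ y, i y * k = i x} =
      Nat.card {x // ¬ ∃ y, i x * k = i y} := fun k =>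
    natCard_not_exists_swap (fun x y => i x * k = i y) (fun x y z hy hz => hi (hy.symm.trans hz))
      (fun x y z hx hy => hi (mul_left_injective k (hx.trans hy.symm)))
  -- Right translations reverse products; their inverse partial maps restore the order.
  refine ⟨Fin (n + 1), inferInstance, inferInstance,
    exists_almost_morphism_of_partial_action (K : Set M) hε (fun s x y => i y * s = i x)
      (fun s x y z hy hz => hi (mul_left_injective s (hy.trans hz.symm))) ?_
      (fun x => mul_one _)
      (fun s t x y hs ht => mul_right_injective (i y) (hs.trans ht.symm)) ?_ ?_⟩
  · intro s t x y z hy hz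
    refine mul_left_injective t ?_
    change i z * s * t = i y * t
    rw [mul_assoc, hz, hy]
  · intro k hk
    rw [Fintype.card_fin, hswap]
    exact h k (Finset.mem_union_left _ hk)
  · intro k hk l hl
    rw [Fintype.card_fin, hswap]
    exact h (k * l) (Finset.mem_union_right _ (Finset.mem_image₂_of_mem hk hl))

end SoficMonoids

theorem proposition4p6 (M : Type*) [Monoid M] [IsCancelMul M]
    (hM : SoficMonoids.IsLeftAmenable M ∨ SoficMonoids.IsRightAmenable M) :
    SoficMonoids.IsSofic M := by
  exact hM.elim SoficMonoids.IsLeftAmenable.isSofic SoficMonoids.IsRightAmenable.isSofic
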